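/- Let $X \in \mathbb{C}^{n\times n}$ have no eigenvalues on $(-\infty,0]$, and let $R = X^{1/2}$ be its principal square root, i.e. the matrix obtained by applying the principal branch of the scalar square root to $X$ through the holomorphic functional calculus, $$R=\frac{1}{2\pi i}\oint_\gamma z^{1/2}\,(z-X)^{-1}\,dz,$$ where $\gamma$ is a positively oriented contour that encloses the spectrum of $X$ and lies in $\mathbb{C}\setminus(-\infty,0]$ (for instance the union of small disjoint circles around the distinct eigenvalues of $X$). Then the following are all true. 1. If $X$ is unitary, then $R$ is unitary. 2. If $X$ is complex symmetric ($X^{\top}=X$), then $R$ is complex symmetric. 3. If all entries of $X$ are real, then all entries of $R$ are real. 4. If $n=2m$ is even and $X$ is self-dual, i.e. $X^{\sharp}=X$ for $X^{\sharp}=-ZX^{\top}Z$ with $Z=\begin{pmatrix}0&I_m\\-I_m&0\end{pmatrix}$, then $R$ is self-dual. 5. If $\Gamma\in\mathbb{C}^{n\times n}$ is unitary with $\Gamma^2=I$ and $\Gamma X\Gamma=X^{\dagger}$, where $\dagger$ denotes the conjugate transpose, then $\Gamma R\Gamma=R^{\dagger}$. -/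

import Mathlib

noncomputable section

namespace RootSymmetry

/-- The finite set of (distinct) eigenvalues of a complex matrix. -/
def eigenvalueSet {n : ℕ} (X : Matrix (Fin n) (Fin n) ℂ) : Finset ℂ :=
  X.charpoly.roots.toFinset

/-- `X` has no eigenvalue on `(-∞, 0]`. -/
def NoNonposEigenvalue {n : ℕ} (X : Matrix (Fin n) (Fin n) ℂ) : Prop :=
  ∀ t : ℝ, t ≤ 0 → ¬ Module.End.HasEigenvalue (Matrix.toLin' X) (t : ℂ)

/-- One third of the distance from `μ` to the other eigenvalues of `X` and to the half line
`(-∞, 0]` (which is the complement of `Complex.slitPlane`).  For the eigenvalues of a matrix without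
eigenvalues on `(-∞, 0]`, the closed discs with these radii are nondegenerate, pairwise disjoint
and contained in the slit plane. -/
def contourRadius {n : ℕ} (X : Matrix (Fin n) (Fin n) ℂ) (μ : ℂ) : ℝ :=
  Metric.infDist μ (((eigenvalueSet X : Set ℂ) \ {μ}) ∪ Complex.slitPlaneᶜ) / 3

/-- The holomorphic functional calculus `f(X) = (2πi)⁻¹ ∮_γ f(z) (z - X)⁻¹ dz` for functions `f`
holomorphic on `ℂ \ (-∞, 0]`.  The contour `γ`, which encloses the spectrum of `X` and avoids
`(-∞, 0]`, consists of one positively oriented circle around each eigenvalue of `X`.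
The integral of a matrix-valued function is taken entry by entry. -/
def holomorphicCalculus {n : ℕ} (f : ℂ → ℂ) (X : Matrix (Fin n) (Fin n) ℂ) :
    Matrix (Fin n) (Fin n) ℂ :=
  Matrix.of fun i j =>
    (2 * (Real.pi : ℂ) * Complex.I)⁻¹ *
      ∑ μ ∈ eigenvalueSet X,
        ∮ z in C(μ, contourRadius X μ),
          f z * ((z • (1 : Matrix (Fin n) (Fin n) ℂ) - X)⁻¹) i j

/-- The principal square root `X^{1/2}`: the principal branch of the scalar square root, applied
to `X` through the holomorphic functional calculus. -/
def principalSqrt {n : ℕ} (X : Matrix (Fin n) (Fin n) ℂ) : Matrix (Fin n) (Fin n) ℂ :=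
  holomorphicCalculus (fun z => z ^ (1 / 2 : ℂ)) X

/-- The matrix `Z = [[0, I], [-I, 0]]` of even size `n = m + m`, with blocks of size `m`. -/
def skewZ {m n : ℕ} (h : m + m = n) : Matrix (Fin n) (Fin n) ℂ :=
  Matrix.reindex (finSumFinEquiv.trans (finCongr h)) (finSumFinEquiv.trans (finCongr h))
    (Matrix.fromBlocks (0 : Matrix (Fin m) (Fin m) ℂ) 1 (-1) 0)

/-- The dual operation `X♯ = -Z Xᵀ Z` on matrices of even size. -/
def dual {m n : ℕ} (h : m + m = n) (X : Matrix (Fin n) (Fin n) ℂ) : Matrix (Fin n) (Fin n) ℂ :=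
  -(skewZ h * X.transpose * skewZ h)

/-- `X` is self-dual if `X♯ = X`. -/
def IsSelfDual {m n : ℕ} (h : m + m = n) (X : Matrix (Fin n) (Fin n) ℂ) : Prop :=
  dual h X = X

/-- All entries of `X` are real. -/
def IsRealMatrix {n : ℕ} (X : Matrix (Fin n) (Fin n) ℂ) : Prop :=
  ∀ i j, (X i j).im = 0

end RootSymmetry

end

/-!
The calculus `X ↦ f(X)` commutes with transposition and with `X ↦ P X Q` for `P Q = 1`, since these
act linearly on the resolvent and leave the contour unchanged. If `f (conj z) = conj (f z)`,
it commutes with the conjugate transpose, which reflects the contour in the real axis. Symmetry,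
reality, self-duality and `Γ X Γ = Xᴴ` are equations between images of `X` under these operations,
so they pass from `X` to `f(X)`.

Unitarity is preserved because the eigenvectors of a unitary `X` span: if `X v = μ v` then
`Xᴴ v = conj μ v`, so Cauchy's formula gives `f(X)ᴴ f(X) v = |f(μ)|² v = v`, using `|f| = 1` on the
unit circle.
-/

open Matrix ComplexConjugate

namespace RootSymmetry

section Matrices

variable {ι : Type*} [Fintype ι] [DecidableEq ι]

theorem charpoly_conj_of_mul_eq_one {R : Type*} [CommRing R] {P Q : Matrix ι ι R}
    (hPQ : P * Q = 1) (X : Matrix ι ι R) : (P * X * Q).charpoly = X.charpoly := by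
  rw [charpoly_mul_comm, ← mul_assoc, mul_eq_one_comm.1 hPQ, one_mul]

theorem inv_smul_one_sub_conj {R : Type*} [CommRing R] {P Q : Matrix ι ι R} (hPQ : P * Q = 1)
    (X : Matrix ι ι R) (z : R) : (z • 1 - P * X * Q)⁻¹ = P * (z • 1 - X)⁻¹ * Q := by
  have hconj : z • 1 - P * X * Q = P * (z • 1 - X) * Q := by
    rw [mul_sub, sub_mul, mul_smul_comm, smul_mul_assoc, mul_one, hPQ]
  rw [hconj, Matrix.mul_inv_rev, Matrix.mul_inv_rev, inv_eq_right_inv hPQ, inv_eq_left_inv hPQ,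
    mul_assoc]

theorem isUnit_smul_one_sub_iff_notMem_spectrum {K : Type*} [Field K] {X : Matrix ι ι K} {z : K} :
    IsUnit (z • 1 - X) ↔ z ∉ spectrum K X := by
  rw [spectrum.notMem_iff, Algebra.algebraMap_eq_smul_one]

theorem inv_smul_one_sub_mulVec_of_mulVec_eq_smul {K : Type*} [Field K] {X : Matrix ι ι K}
    {v : ι → K} {z μ : K} (hv : X *ᵥ v = μ • v) (hz : z ∉ spectrum K X) :
    (z • 1 - X)⁻¹ *ᵥ v = (z - μ)⁻¹ • v := by
  have hunit := (isUnit_iff_isUnit_det _).1 (isUnit_smul_one_sub_iff_notMem_spectrum.2 hz)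
  have hmul : v = (z - μ) • (z • 1 - X)⁻¹ *ᵥ v := by
    rw [← mulVec_smul, sub_smul, ← hv, ← one_mulVec (z • v), mulVec_smul, ← smul_mulVec,
      ← sub_mulVec, mulVec_mulVec, nonsing_inv_mul _ hunit, one_mulVec]
  rcases eq_or_ne z μ with rfl | hne
  · rw [sub_self, zero_smul] at hmul
    rw [hmul, mulVec_zero, smul_zero]
  · exact ((inv_smul_eq_iff₀ (sub_ne_zero.2 hne)).2 hmul).symm

theorem continuousOn_inv_smul_one_sub {K : Type*} [Field K] [TopologicalSpace K]
    [IsTopologicalDivisionRing K] (X : Matrix ι ι K) :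
    ContinuousOn (fun z : K => (z • 1 - X)⁻¹) (spectrum K X)ᶜ := by
  have hcont : Continuous fun z : K => z • 1 - X := by fun_prop
  simp only [inv_def, Ring.inverse_eq_inv']
  refine (hcont.matrix_det.continuousOn.inv₀ fun z hz => ?_).smul
    hcont.matrix_adjugate.continuousOn
  exact ((isUnit_iff_isUnit_det _).1 (isUnit_smul_one_sub_iff_notMem_spectrum.2 hz)).ne_zero

theorem isSemisimple_toLin'_of_isHermitian {𝕜 : Type*} [RCLike 𝕜] {A : Matrix ι ι 𝕜}
    (hA : A.IsHermitian) : Module.End.IsSemisimple (toLin' A) :=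
  (LinearEquiv.isSemisimple_iff (toEuclideanLin A) (toLin' A) (WithLp.linearEquiv 2 𝕜 (ι → 𝕜))
    rfl).1 (Module.End.isFinitelySemisimple_iff_isSemisimple.1
      (isSymmetric_toEuclideanLin_iff.2 hA).isFinitelySemisimple)

-- The real and imaginary parts of a normal matrix are commuting semisimple operators.
open scoped ComplexStarModule in
theorem isSemisimple_toLin'_of_isStarNormal {X : Matrix ι ι ℂ} (hX : IsStarNormal X) :
    Module.End.IsSemisimple (toLin' X) := by
  have hcomm : Commute (toLin' (ℜ X : Matrix ι ι ℂ)) (Complex.I • toLin' (ℑ X : Matrix ι ι ℂ)) :=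
    ((isStarNormal_iff_commute_realPart_imaginaryPart.1 hX).map
      (toLinAlgEquiv' : Matrix ι ι ℂ ≃ₐ[ℂ] _)).smul_right Complex.I
  rw [← realPart_add_I_smul_imaginaryPart X, map_add, map_smul]
  exact (isSemisimple_toLin'_of_isHermitian (ℜ X).2).add_of_commute hcomm
    (Module.End.IsSemisimple_smul _ (isSemisimple_toLin'_of_isHermitian (ℑ X).2))

theorem ext_of_eigenvectors_of_isStarNormal {X A B : Matrix ι ι ℂ} (hX : IsStarNormal X)
    (h : ∀ μ v, Module.End.HasEigenvector (toLin' X) μ v → A *ᵥ v = B *ᵥ v) : A = B := by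
  have hspan : ⨆ μ, Module.End.eigenspace (toLin' X) μ = ⊤ :=
    (isSemisimple_toLin'_of_isStarNormal hX).iSup_eigenspace_eq_top
  have heq : (⊤ : Submodule ℂ (ι → ℂ)) ≤ LinearMap.eqLocus (toLin' A) (toLin' B) := by
    refine hspan ▸ iSup_le fun μ v hv => ?_
    rcases eq_or_ne v 0 with rfl | hne
    · exact zero_mem _
    · exact h μ v ⟨hv, hne⟩
  exact toLin'.injective (LinearMap.ext fun v => heq Submodule.mem_top)

open scoped Matrix.Norms.L2Operator in
theorem norm_eq_one_of_hasEigenvector_of_mem_unitaryGroup {X : Matrix ι ι ℂ}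
    (hX : X ∈ unitaryGroup ι ℂ) {μ : ℂ} {v : ι → ℂ}
    (hv : Module.End.HasEigenvector (toLin' X) μ v) : ‖μ‖ = 1 := by
  have hμ : μ ∈ spectrum ℂ X :=
    spectrum_toLin' X ▸ (Module.End.hasEigenvalue_of_hasEigenvector hv).mem_spectrum
  exact mem_sphere_zero_iff_norm.1 (spectrum.subset_circle_of_unitary hX hμ)

theorem hasEigenvector_conjTranspose_of_mem_unitaryGroup {X : Matrix ι ι ℂ}
    (hX : X ∈ unitaryGroup ι ℂ) {μ : ℂ} {v : ι → ℂ}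
    (hv : Module.End.HasEigenvector (toLin' X) μ v) :
    Module.End.HasEigenvector (toLin' Xᴴ) (conj μ) v := by
  refine ⟨Module.End.mem_eigenspace_iff.2 ?_, hv.2⟩
  have hμ : conj μ * μ = 1 := by
    rw [Complex.conj_mul', norm_eq_one_of_hasEigenvector_of_mem_unitaryGroup hX hv]
    norm_num
  calc Xᴴ *ᵥ v = conj μ • Xᴴ *ᵥ (μ • v) := by rw [mulVec_smul, smul_smul, hμ, one_smul]
    _ = conj μ • (Xᴴ * X) *ᵥ v := by rw [← hv.apply_eq_smul, toLin'_apply, mulVec_mulVec]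
    _ = conj μ • v := by rw [← star_eq_conjTranspose, mem_unitaryGroup_iff'.1 hX, one_mulVec]

end Matrices

theorem conj_circleIntegral (g : ℂ → ℂ) (c : ℂ) (r : ℝ) :
    conj (∮ z in C(c, r), g z) = -∮ z in C(conj c, r), conj (g (conj z)) := by
  set F : ℝ → ℂ := fun θ =>
    deriv (circleMap (conj c) r) θ • conj (g (conj (circleMap (conj c) r θ))) with hF
  have hreflect (θ : ℝ) : conj (deriv (circleMap c r) θ • g (circleMap c r θ)) = -F (-θ) := by
    simp [hF, conj_circleMap]
  have hperiodic : Function.Periodic F (2 * Real.pi) := fun θ => by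
    simp only [hF, deriv_circleMap, periodic_circleMap _ _ θ]
  calc conj (∮ z in C(c, r), g z) = ∫ θ in 0..2 * Real.pi, -F (-θ) := by
        simp only [circleIntegral, ← intervalIntegral.intervalIntegral_conj, hreflect]
    _ = -∫ θ in -(2 * Real.pi)..0, F θ := by
        rw [intervalIntegral.integral_neg, intervalIntegral.integral_comp_neg, neg_zero]
    _ = -∫ θ in 0..2 * Real.pi, F θ := by
        simpa using hperiodic.intervalIntegral_add_eq (-(2 * Real.pi)) 0

theorem image_conj_slitPlane : conj '' Complex.slitPlane = Complex.slitPlane := by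
  rw [Set.image_eq_preimage_of_inverse Complex.conj_conj Complex.conj_conj]
  ext z
  simp [Complex.mem_slitPlane_iff]

variable {n : ℕ} {X : Matrix (Fin n) (Fin n) ℂ} {f : ℂ → ℂ}

theorem coe_eigenvalueSet (X : Matrix (Fin n) (Fin n) ℂ) :
    (eigenvalueSet X : Set ℂ) = spectrum ℂ X := by
  ext z
  rw [Finset.mem_coe, eigenvalueSet, Multiset.mem_toFinset,
    Polynomial.mem_roots (charpoly_monic X).ne_zero, mem_spectrum_iff_isRoot_charpoly]

theorem mem_eigenvalueSet_of_hasEigenvector {μ : ℂ} {v : Fin n → ℂ}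
    (hv : Module.End.HasEigenvector (toLin' X) μ v) : μ ∈ eigenvalueSet X := by
  rw [← Finset.mem_coe, coe_eigenvalueSet, ← spectrum_toLin']
  exact (Module.End.hasEigenvalue_of_hasEigenvector hv).mem_spectrum

theorem coe_eigenvalueSet_conjTranspose (X : Matrix (Fin n) (Fin n) ℂ) :
    (eigenvalueSet Xᴴ : Set ℂ) = conj '' eigenvalueSet X := by
  rw [coe_eigenvalueSet, coe_eigenvalueSet, ← star_eq_conjTranspose, spectrum.map_star]
  exact Set.image_star.symm

theorem noNonposEigenvalue_iff_spectrum_subset_slitPlane :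
    NoNonposEigenvalue X ↔ spectrum ℂ X ⊆ Complex.slitPlane := by
  simp only [NoNonposEigenvalue, Module.End.hasEigenvalue_iff_mem_spectrum, spectrum_toLin']
  constructor
  · intro h z hz
    by_contra hslit
    rw [Complex.mem_slitPlane_iff, not_or, not_lt, not_not] at hslit
    exact h z.re hslit.1 (by rwa [Complex.ext (Complex.ofReal_re z.re) hslit.2.symm])
  · intro h t ht hmem
    exact ht.not_gt (Complex.ofReal_mem_slitPlane.1 (h hmem))

theorem NoNonposEigenvalue.mem_slitPlane (hX : NoNonposEigenvalue X) {μ : ℂ}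
    (hμ : μ ∈ eigenvalueSet X) : μ ∈ Complex.slitPlane :=
  noNonposEigenvalue_iff_spectrum_subset_slitPlane.1 hX (coe_eigenvalueSet X ▸ hμ)

theorem NoNonposEigenvalue.transpose (hX : NoNonposEigenvalue X) : NoNonposEigenvalue Xᵀ := by
  rw [noNonposEigenvalue_iff_spectrum_subset_slitPlane, ← coe_eigenvalueSet, eigenvalueSet,
    charpoly_transpose, ← eigenvalueSet, coe_eigenvalueSet]
  exact noNonposEigenvalue_iff_spectrum_subset_slitPlane.1 hX

theorem NoNonposEigenvalue.conjTranspose (hX : NoNonposEigenvalue X) : NoNonposEigenvalue Xᴴ := by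
  rw [noNonposEigenvalue_iff_spectrum_subset_slitPlane, ← coe_eigenvalueSet,
    coe_eigenvalueSet_conjTranspose, ← image_conj_slitPlane]
  exact Set.image_mono fun _ => hX.mem_slitPlane

theorem contourRadius_nonneg (X : Matrix (Fin n) (Fin n) ℂ) (μ : ℂ) : 0 ≤ contourRadius X μ :=
  div_nonneg Metric.infDist_nonneg zero_le_three

theorem contourRadius_pos {μ : ℂ} (hμ : μ ∈ Complex.slitPlane) : 0 < contourRadius X μ := by
  have hclosed : IsClosed (((eigenvalueSet X : Set ℂ) \ {μ}) ∪ Complex.slitPlaneᶜ) :=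
    ((eigenvalueSet X).finite_toSet.subset Set.sdiff_subset).isClosed.union
      Complex.isOpen_slitPlane.isClosed_compl
  have hne : (((eigenvalueSet X : Set ℂ) \ {μ}) ∪ Complex.slitPlaneᶜ).Nonempty :=
    ⟨0, Or.inr Complex.zero_notMem_slitPlane⟩
  refine div_pos ((hclosed.notMem_iff_infDist_pos hne).1 ?_) zero_lt_three
  rintro (h | h)
  · exact h.2 rfl
  · exact h hμ

theorem contourRadius_conjTranspose (X : Matrix (Fin n) (Fin n) ℂ) (μ : ℂ) :
    contourRadius Xᴴ (conj μ) = contourRadius X μ := by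
  have hbij : Function.Bijective (conj : ℂ → ℂ) := (starRingAut (R := ℂ)).bijective
  have himage : ((eigenvalueSet Xᴴ : Set ℂ) \ {conj μ}) ∪ Complex.slitPlaneᶜ =
      conj '' (((eigenvalueSet X : Set ℂ) \ {μ}) ∪ Complex.slitPlaneᶜ) := by
    rw [Set.image_union, Set.image_sdiff hbij.1, Set.image_singleton, Set.image_compl_eq hbij,
      image_conj_slitPlane, coe_eigenvalueSet_conjTranspose]
  rw [contourRadius, contourRadius, himage]
  exact congrArg (· / 3) (Metric.infDist_image Complex.conjLIE.isometry)

theorem disjoint_closedBall_contourRadius {μ : ℂ} (hμ : μ ∈ Complex.slitPlane) :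
    Disjoint (Metric.closedBall μ (contourRadius X μ))
      (((eigenvalueSet X : Set ℂ) \ {μ}) ∪ Complex.slitPlaneᶜ) := by
  refine Metric.disjoint_closedBall_of_lt_infDist ?_
  have hpos := contourRadius_pos (X := X) hμ
  unfold contourRadius at hpos ⊢
  linarith

theorem closedBall_contourRadius_subset_slitPlane {μ : ℂ} (hμ : μ ∈ Complex.slitPlane) :
    Metric.closedBall μ (contourRadius X μ) ⊆ Complex.slitPlane :=
  Set.disjoint_compl_right_iff_subset.1
    ((disjoint_closedBall_contourRadius hμ).mono_right Set.subset_union_right)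

theorem eq_center_of_mem_closedBall_contourRadius {μ ν : ℂ} (hμ : μ ∈ Complex.slitPlane)
    (hν : ν ∈ Metric.closedBall μ (contourRadius X μ)) (hνX : ν ∈ eigenvalueSet X) : ν = μ := by
  by_contra hne
  exact (disjoint_closedBall_contourRadius hμ).notMem_of_mem_left hν (Or.inl ⟨hνX, hne⟩)

/-- The contour `γ` over which `holomorphicCalculus` integrates, as a set: the union of the circles
around the eigenvalues of `X`. -/
def contour (X : Matrix (Fin n) (Fin n) ℂ) : Set ℂ :=
  ⋃ μ ∈ eigenvalueSet X, Metric.sphere μ (contourRadius X μ)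

/-- The normalised contour integral `(2πi)⁻¹ ∮_γ g(z) dz` over the contour of `X`. -/
noncomputable def contourIntegral (X : Matrix (Fin n) (Fin n) ℂ) (g : ℂ → ℂ) : ℂ :=
  (2 * (Real.pi : ℂ) * Complex.I)⁻¹ *
    ∑ μ ∈ eigenvalueSet X, ∮ z in C(μ, contourRadius X μ), g z

theorem sphere_subset_contour {μ : ℂ} (hμ : μ ∈ eigenvalueSet X) :
    Metric.sphere μ (contourRadius X μ) ⊆ contour X :=
  Set.subset_biUnion_of_mem (u := fun μ => Metric.sphere μ (contourRadius X μ)) hμ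

theorem contour_subset_slitPlane (hX : NoNonposEigenvalue X) : contour X ⊆ Complex.slitPlane :=
  Set.iUnion₂_subset fun _ hμ => Metric.sphere_subset_closedBall.trans
    (closedBall_contourRadius_subset_slitPlane (hX.mem_slitPlane hμ))

theorem contour_subset_compl_spectrum (hX : NoNonposEigenvalue X) :
    contour X ⊆ (spectrum ℂ X)ᶜ := by
  refine Set.iUnion₂_subset fun μ hμ z hz hzX => ?_
  rw [← coe_eigenvalueSet] at hzX
  have hslit := hX.mem_slitPlane hμ
  have hzμ := eq_center_of_mem_closedBall_contourRadius hslit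
    (Metric.sphere_subset_closedBall hz) hzX
  rw [hzμ, Metric.mem_sphere, dist_self] at hz
  exact (contourRadius_pos hslit).ne hz

theorem contourIntegral_congr {g₁ g₂ : ℂ → ℂ} (h : Set.EqOn g₁ g₂ (contour X)) :
    contourIntegral X g₁ = contourIntegral X g₂ :=
  congrArg (_ * ·) <| Finset.sum_congr rfl fun μ hμ => circleIntegral.integral_congr
    (contourRadius_nonneg X μ) (h.mono (sphere_subset_contour hμ))

theorem contourIntegral_mul_const (g : ℂ → ℂ) (a : ℂ) :
    contourIntegral X (fun z => g z * a) = contourIntegral X g * a := by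
  simp only [contourIntegral, mul_comm _ a, circleIntegral.integral_const_mul, ← Finset.mul_sum]
  ring

theorem contourIntegral_sum {κ : Type*} {s : Finset κ} {g : κ → ℂ → ℂ}
    (hg : ∀ k ∈ s, ContinuousOn (g k) (contour X)) :
    contourIntegral X (fun z => ∑ k ∈ s, g k z) = ∑ k ∈ s, contourIntegral X (g k) := by
  have hcircle (μ : ℂ) (hμ : μ ∈ eigenvalueSet X) :
      (∮ z in C(μ, contourRadius X μ), ∑ k ∈ s, g k z) =
        ∑ k ∈ s, ∮ z in C(μ, contourRadius X μ), g k z :=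
    circleIntegral.integral_fun_sum fun k hk =>
      ((hg k hk).mono (sphere_subset_contour hμ)).circleIntegrable (contourRadius_nonneg X μ)
  simp only [contourIntegral]
  rw [Finset.sum_congr rfl hcircle, Finset.sum_comm, Finset.mul_sum]

theorem conj_contourIntegral (X : Matrix (Fin n) (Fin n) ℂ) (g : ℂ → ℂ) :
    conj (contourIntegral X g) = contourIntegral Xᴴ fun z => conj (g (conj z)) := by
  have himage : eigenvalueSet Xᴴ = (eigenvalueSet X).image conj := by
    rw [← Finset.coe_inj, Finset.coe_image, coe_eigenvalueSet_conjTranspose]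
  have hconst : conj (2 * (Real.pi : ℂ) * Complex.I)⁻¹ = -(2 * (Real.pi : ℂ) * Complex.I)⁻¹ := by
    simp [map_ofNat]
  simp only [contourIntegral, map_mul, map_sum, hconst, conj_circleIntegral,
    Finset.sum_neg_distrib, neg_mul_neg, himage,
    Finset.sum_image (starRingEnd ℂ).injective.injOn, contourRadius_conjTranspose]

theorem contourIntegral_mul_sub_inv (hf : DifferentiableOn ℂ f Complex.slitPlane)
    (hX : NoNonposEigenvalue X) {μ : ℂ} (hμ : μ ∈ eigenvalueSet X) :
    contourIntegral X (fun z => f z * (z - μ)⁻¹) = f μ := by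
  have hdiff {ν : ℂ} (hν : ν ∈ eigenvalueSet X) :
      DifferentiableOn ℂ f (Metric.closedBall ν (contourRadius X ν)) :=
    hf.mono (closedBall_contourRadius_subset_slitPlane (hX.mem_slitPlane hν))
  have hcenter : (∮ z in C(μ, contourRadius X μ), f z * (z - μ)⁻¹) =
      2 * (Real.pi : ℂ) * Complex.I * f μ := by
    simpa only [smul_eq_mul, mul_comm (f _)] using (hdiff hμ).circleIntegral_sub_inv_smul
      (Metric.mem_ball_self (contourRadius_pos (hX.mem_slitPlane hμ)))
  have hother {ν : ℂ} (hν : ν ∈ eigenvalueSet X) (hne : ν ≠ μ) :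
      (∮ z in C(ν, contourRadius X ν), f z * (z - μ)⁻¹) = 0 := by
    refine DiffContOnCl.circleIntegral_eq_zero (contourRadius_nonneg X ν)
      (((hdiff hν).mul ?_).diffContOnCl_ball subset_rfl)
    refine (differentiableOn_id.sub_const μ).inv fun z hz => sub_ne_zero.2 ?_
    rintro rfl
    exact hne (eq_center_of_mem_closedBall_contourRadius (hX.mem_slitPlane hν) hz hμ).symm
  rw [contourIntegral, Finset.sum_eq_single_of_mem μ hμ fun _ hν hne => hother hν hne, hcenter,
    inv_mul_cancel_left₀ Complex.two_pi_I_ne_zero]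

theorem holomorphicCalculus_apply (f : ℂ → ℂ) (X : Matrix (Fin n) (Fin n) ℂ) (i j : Fin n) :
    holomorphicCalculus f X i j = contourIntegral X fun z => f z * (z • 1 - X)⁻¹ i j :=
  rfl

theorem holomorphicCalculus_congr {g : ℂ → ℂ} (hX : NoNonposEigenvalue X)
    (h : Set.EqOn f g Complex.slitPlane) : holomorphicCalculus f X = holomorphicCalculus g X := by
  ext i j
  exact contourIntegral_congr fun z hz => by simp only [h (contour_subset_slitPlane hX hz)]

theorem linearMap_holomorphicCalculus (φ : Matrix (Fin n) (Fin n) ℂ →ₗ[ℂ] ℂ)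
    (hf : ContinuousOn f Complex.slitPlane) (hX : NoNonposEigenvalue X) :
    φ (holomorphicCalculus f X) = contourIntegral X fun z => f z * φ (z • 1 - X)⁻¹ := by
  obtain ⟨c, hc⟩ : ∃ c : Fin n × Fin n → ℂ, ∀ A, φ A = ∑ p, A p.1 p.2 * c p := by
    refine ⟨fun p => φ (single p.1 p.2 1), fun A => ?_⟩
    conv_lhs => rw [matrix_eq_sum_single A]
    simp only [map_sum, Fintype.sum_prod_type, ← smul_eq_mul, ← map_smul, smul_single]
    simp only [smul_eq_mul, mul_one]
  have hcont (p : Fin n × Fin n) :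
      ContinuousOn (fun z => f z * (z • 1 - X)⁻¹ p.1 p.2 * c p) (contour X) := by
    have hresolvent := (continuousOn_inv_smul_one_sub X).mono (contour_subset_compl_spectrum hX)
    exact ((hf.mono (contour_subset_slitPlane hX)).mul
      ((continuous_id.matrix_elem p.1 p.2).comp_continuousOn hresolvent)).mul_const _
  simp only [hc, Finset.mul_sum, ← mul_assoc]
  rw [contourIntegral_sum fun p _ => hcont p]
  simp only [contourIntegral_mul_const, holomorphicCalculus_apply]

theorem holomorphicCalculus_transpose (f : ℂ → ℂ) (X : Matrix (Fin n) (Fin n) ℂ) :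
    holomorphicCalculus f Xᵀ = (holomorphicCalculus f X)ᵀ := by
  have hresolvent (z : ℂ) : (z • 1 - Xᵀ)⁻¹ = (z • 1 - X)⁻¹ᵀ := by
    rw [transpose_nonsing_inv, transpose_sub, transpose_smul, transpose_one]
  ext i j
  simp only [holomorphicCalculus, contourRadius, eigenvalueSet, charpoly_transpose, hresolvent,
    of_apply, transpose_apply]

theorem conjTranspose_holomorphicCalculus (f : ℂ → ℂ) (X : Matrix (Fin n) (Fin n) ℂ) :
    (holomorphicCalculus f X)ᴴ = holomorphicCalculus (fun z => conj (f (conj z))) Xᴴ := by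
  have hresolvent (z : ℂ) : (z • 1 - Xᴴ)⁻¹ = (conj z • 1 - X)⁻¹ᴴ := by
    rw [conjTranspose_nonsing_inv, conjTranspose_sub, conjTranspose_smul, conjTranspose_one,
      starRingEnd_apply, star_star]
  ext i j
  simp only [conjTranspose_apply, holomorphicCalculus_apply, ← starRingEnd_apply,
    conj_contourIntegral, hresolvent, map_mul]

theorem holomorphicCalculus_conjTranspose
    (hconj : ∀ z ∈ Complex.slitPlane, f (conj z) = conj (f z)) (hX : NoNonposEigenvalue X) :
    holomorphicCalculus f Xᴴ = (holomorphicCalculus f X)ᴴ := by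
  rw [conjTranspose_holomorphicCalculus]
  refine holomorphicCalculus_congr hX.conjTranspose fun z hz => ?_
  rw [← Complex.conj_conj (f z), ← hconj z hz]

theorem holomorphicCalculus_conj (hf : ContinuousOn f Complex.slitPlane)
    (hX : NoNonposEigenvalue X) {P Q : Matrix (Fin n) (Fin n) ℂ} (hPQ : P * Q = 1) :
    holomorphicCalculus f (P * X * Q) = P * holomorphicCalculus f X * Q := by
  ext i j
  let φ : Matrix (Fin n) (Fin n) ℂ →ₗ[ℂ] ℂ :=
    entryLinearMap ℂ ℂ i j ∘ₗ LinearMap.mulRight ℂ Q ∘ₗ LinearMap.mulLeft ℂ P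
  calc holomorphicCalculus f (P * X * Q) i j
      = contourIntegral X fun z => f z * φ (z • 1 - X)⁻¹ := by
        simp only [holomorphicCalculus_apply, contourIntegral, contourRadius, eigenvalueSet,
          charpoly_conj_of_mul_eq_one hPQ, inv_smul_one_sub_conj hPQ]
        rfl
    _ = (P * holomorphicCalculus f X * Q) i j := (linearMap_holomorphicCalculus φ hf hX).symm

theorem holomorphicCalculus_mulVec_of_hasEigenvector (hf : DifferentiableOn ℂ f Complex.slitPlane)
    (hX : NoNonposEigenvalue X) {μ : ℂ} {v : Fin n → ℂ}
    (hv : Module.End.HasEigenvector (toLin' X) μ v) :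
    holomorphicCalculus f X *ᵥ v = f μ • v := by
  ext i
  let φ : Matrix (Fin n) (Fin n) ℂ →ₗ[ℂ] ℂ := LinearMap.proj i ∘ₗ (mulVecBilin ℂ ℂ).flip v
  calc (holomorphicCalculus f X *ᵥ v) i
      = contourIntegral X fun z => f z * ((z • 1 - X)⁻¹ *ᵥ v) i :=
        linearMap_holomorphicCalculus φ hf.continuousOn hX
    _ = contourIntegral X fun z => f z * (z - μ)⁻¹ * v i :=
        contourIntegral_congr fun z hz => by
          simp only [inv_smul_one_sub_mulVec_of_mulVec_eq_smul hv.apply_eq_smul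
            (contour_subset_compl_spectrum hX hz), Pi.smul_apply, smul_eq_mul, mul_assoc]
    _ = f μ * v i := by
        rw [contourIntegral_mul_const,
          contourIntegral_mul_sub_inv hf hX (mem_eigenvalueSet_of_hasEigenvector hv)]

theorem conjTranspose_holomorphicCalculus_mulVec_of_hasEigenvector
    (hf : DifferentiableOn ℂ f Complex.slitPlane) (hX : NoNonposEigenvalue X)
    {μ : ℂ} {v : Fin n → ℂ} (hv : Module.End.HasEigenvector (toLin' Xᴴ) (conj μ) v) :
    (holomorphicCalculus f X)ᴴ *ᵥ v = conj (f μ) • v := by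
  have hf' : DifferentiableOn ℂ (fun z => conj (f (conj z))) Complex.slitPlane := fun z hz => by
    have hz' : conj z ∈ Complex.slitPlane := image_conj_slitPlane ▸ Set.mem_image_of_mem conj hz
    have hfz := hf.differentiableAt (Complex.isOpen_slitPlane.mem_nhds hz')
    simpa [Function.comp_def] using hfz.conj_conj.differentiableWithinAt
  rw [conjTranspose_holomorphicCalculus,
    holomorphicCalculus_mulVec_of_hasEigenvector hf' hX.conjTranspose hv, Complex.conj_conj]

theorem holomorphicCalculus_mem_unitaryGroup (hf : DifferentiableOn ℂ f Complex.slitPlane)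
    (hnorm : ∀ z ∈ Complex.slitPlane, ‖z‖ = 1 → ‖f z‖ = 1) (hX : NoNonposEigenvalue X)
    (hXu : X ∈ unitaryGroup (Fin n) ℂ) : holomorphicCalculus f X ∈ unitaryGroup (Fin n) ℂ := by
  rw [mem_unitaryGroup_iff', star_eq_conjTranspose]
  have hnormal : IsStarNormal X := ⟨hXu.1.trans hXu.2.symm⟩
  refine ext_of_eigenvectors_of_isStarNormal hnormal fun μ v hv => ?_
  have hfμ : f μ * conj (f μ) = 1 := by
    rw [Complex.mul_conj', hnorm μ (hX.mem_slitPlane (mem_eigenvalueSet_of_hasEigenvector hv))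
      (norm_eq_one_of_hasEigenvector_of_mem_unitaryGroup hXu hv)]
    norm_num
  rw [← mulVec_mulVec, holomorphicCalculus_mulVec_of_hasEigenvector hf hX hv, mulVec_smul,
    conjTranspose_holomorphicCalculus_mulVec_of_hasEigenvector hf hX
      (hasEigenvector_conjTranspose_of_mem_unitaryGroup hXu hv), smul_smul, hfμ, one_smul,
    one_mulVec]

theorem isRealMatrix_iff_conjTranspose_eq_transpose : IsRealMatrix X ↔ Xᴴ = Xᵀ := by
  simp only [IsRealMatrix, ← Matrix.ext_iff, conjTranspose_apply, transpose_apply,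
    ← starRingEnd_apply, Complex.conj_eq_iff_im]
  exact forall_comm

theorem skewZ_mul_skewZ {m : ℕ} (h : m + m = n) : skewZ h * skewZ h = -1 := by
  have hJ : fromBlocks (0 : Matrix (Fin m) (Fin m) ℂ) 1 (-1) 0 = -J (Fin m) ℂ := by
    rw [J, fromBlocks_neg, neg_zero, neg_neg]
  rw [skewZ, hJ, reindex_apply, submatrix_mul_equiv, neg_mul_neg, J_squared, submatrix_neg]
  exact congrArg Neg.neg (submatrix_one_equiv _)

theorem dual_eq_conj_transpose {m : ℕ} (h : m + m = n) (X : Matrix (Fin n) (Fin n) ℂ) :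
    dual h X = -skewZ h * Xᵀ * skewZ h := by
  rw [dual, neg_mul, neg_mul]

theorem holomorphicCalculus_dual {m : ℕ} (h : m + m = n) (hf : ContinuousOn f Complex.slitPlane)
    (hX : NoNonposEigenvalue X) :
    holomorphicCalculus f (dual h X) = dual h (holomorphicCalculus f X) := by
  have hZ : -skewZ h * skewZ h = 1 := by rw [neg_mul, skewZ_mul_skewZ, neg_neg]
  rw [dual_eq_conj_transpose, dual_eq_conj_transpose, holomorphicCalculus_conj hf hX.transpose hZ,
    holomorphicCalculus_transpose]

theorem differentiableOn_cpow_const_slitPlane (a : ℂ) :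
    DifferentiableOn ℂ (fun z : ℂ => z ^ a) Complex.slitPlane :=
  differentiableOn_id.cpow_const fun _ hz => hz

theorem conj_cpow_of_im_eq_zero {z a : ℂ} (ha : a.im = 0) (hz : z ∈ Complex.slitPlane) :
    conj z ^ a = conj (z ^ a) := by
  rw [Complex.conj_cpow _ _ (Complex.slitPlane_arg_ne_pi hz), Complex.conj_eq_iff_im.2 ha]

theorem norm_cpow_of_norm_eq_one_of_im_eq_zero {z a : ℂ} (ha : a.im = 0) (hz : ‖z‖ = 1) :
    ‖z ^ a‖ = 1 := by
  have hz0 : z ≠ 0 := norm_ne_zero_iff.1 (hz ▸ one_ne_zero)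
  simp [Complex.norm_cpow_of_ne_zero hz0, hz, ha]

end RootSymmetry

open RootSymmetry in
theorem mainTheorem6_general (n : ℕ) (f : ℂ → ℂ) (X : Matrix (Fin n) (Fin n) ℂ)
    (hf : DifferentiableOn ℂ f Complex.slitPlane)
    (hconj : ∀ z ∈ Complex.slitPlane, f (conj z) = conj (f z))
    (hnorm : ∀ z ∈ Complex.slitPlane, ‖z‖ = 1 → ‖f z‖ = 1)
    (hX : NoNonposEigenvalue X) :
    (X ∈ unitaryGroup (Fin n) ℂ → holomorphicCalculus f X ∈ unitaryGroup (Fin n) ℂ) ∧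
    (X.IsSymm → (holomorphicCalculus f X).IsSymm) ∧
    (IsRealMatrix X → IsRealMatrix (holomorphicCalculus f X)) ∧
    (∀ (m : ℕ) (h : m + m = n), IsSelfDual h X → IsSelfDual h (holomorphicCalculus f X)) ∧
    (∀ Γ : Matrix (Fin n) (Fin n) ℂ, Γ * Γ = 1 → Γ * X * Γ = Xᴴ →
      Γ * holomorphicCalculus f X * Γ = (holomorphicCalculus f X)ᴴ) := by
  have hadjoint := holomorphicCalculus_conjTranspose hconj hX
  refine ⟨holomorphicCalculus_mem_unitaryGroup hf hnorm hX, fun hsymm => ?_, fun hreal => ?_,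
    fun m h hdual => ?_, fun Γ hΓ hΓX => ?_⟩
  · rw [Matrix.IsSymm, ← holomorphicCalculus_transpose, hsymm.eq]
  · rw [isRealMatrix_iff_conjTranspose_eq_transpose] at hreal ⊢
    rw [← hadjoint, hreal, holomorphicCalculus_transpose]
  · rw [IsSelfDual, ← holomorphicCalculus_dual h hf.continuousOn hX, hdual]
  · rw [← holomorphicCalculus_conj hf.continuousOn hX hΓ, hΓX, hadjoint]

theorem mainTheorem6 (n : ℕ) (X R : Matrix (Fin n) (Fin n) ℂ)
    (hX : RootSymmetry.NoNonposEigenvalue X)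
    (hR : R = RootSymmetry.principalSqrt X) :
    (X ∈ Matrix.unitaryGroup (Fin n) ℂ → R ∈ Matrix.unitaryGroup (Fin n) ℂ) ∧
    (X.IsSymm → R.IsSymm) ∧
    (RootSymmetry.IsRealMatrix X → RootSymmetry.IsRealMatrix R) ∧
    (∀ (m : ℕ) (h : m + m = n),
      RootSymmetry.IsSelfDual h X → RootSymmetry.IsSelfDual h R) ∧
    (∀ Γ : Matrix (Fin n) (Fin n) ℂ,
      Γ ∈ Matrix.unitaryGroup (Fin n) ℂ → Γ * Γ = 1 →
        Γ * X * Γ = X.conjTranspose → Γ * R * Γ = R.conjTranspose) := by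
  have him : (1 / 2 : ℂ).im = 0 := by norm_num
  obtain ⟨hunitary, hsymm, hreal, hdual, hΓ⟩ := mainTheorem6_general n _ X
    (RootSymmetry.differentiableOn_cpow_const_slitPlane (1 / 2))
    (fun _ => RootSymmetry.conj_cpow_of_im_eq_zero him)
    (fun _ _ => RootSymmetry.norm_cpow_of_norm_eq_one_of_im_eq_zero him) hX
  exact hR ▸ ⟨hunitary, hsymm, hreal, hdual, fun Γ _ => hΓ Γ⟩
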